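/- An inversion sequence of length $n\ge 0$ is an integer sequence $e=(e_1,\dots,e_n)$ with $0\le e_j\le j-1$ for all $j$. The reduction of a word is obtained by replacing every occurrence of its $i$-th smallest value by $i-1$; $e$ avoids a pattern $w$ if no subsequence $e_{i_1}e_{i_2}\cdots e_{i_k}$ with $i_1<\dots<i_k$ has reduction $w$. Let $\operatorname{dist}(e)=|\{e_1,\dots,e_n\}|$ be the number of distinct elements of $e$. For a nonempty inversion sequence $e$ avoiding $102$, let $p$ be the position of its first descent, that is, $e_1\le e_2\le\dots\le e_p>e_{p+1}$ with the convention $e_{n+1}=-1$, and let $\operatorname{rank}(e)=p-\max(e)-1$. The empty sequence (the only one of length $0$) has $\operatorname{dist}=\operatorname{rank}=0$. For integers $n,m,t\ge 0$ let $\mathcal{IS}_{n,t}^{(m)}(102,000)$ be the set of inversion sequences $e$ of length $n$ that avoid both $102$ and $000$ and satisfy $\operatorname{dist}(e)=m$ and $\operatorname{rank}(e)=t$. **Theorem.** For all integers $m\ge t\ge 0$, every inversion sequence $e$ (of any length) that avoids $102$ and $000$ and satisfies $\operatorname{dist}(e)=m$ and $\operatorname{rank}(e)=t$ has length between $m$ and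 $2m$, so there are finitely many of them, and their number is $$\left|\bigcup_{n=m}^{2m}\mathcal{IS}_{n,t}^{(m)}(102,000)\right|=\frac{3t+1}{3m+1}\binom{4m-t}{m-t}.$$ In particular, for every $m\ge 0$, the number of such sequences with $\operatorname{dist}(e)=m$ and $\operatorname{rank}(e)=0$ is the $3$-Fuss--Catalan number $$\left|\bigcup_{n=m}^{2m}\mathcal{IS}_{n,0}^{(m)}(102,000)\right|=\frac{1}{3m+1}\binom{4m}{m}.$$ -/

import Mathlib

namespace InvSeq

/-- A finite sequence `e = (e_1, …, e_n)` of natural numbers, given as a list, is an inversion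
sequence if `0 ≤ e_j ≤ j - 1` for `1 ≤ j ≤ n`. The list index `i` is zero-based: `j = i + 1`. -/
def IsInversionSeq (e : List ℕ) : Prop :=
  ∀ (i : ℕ) (hi : i < e.length), e[i] ≤ i

/-- The reduction of a word: every entry equal to the `i`-th smallest value of the word is
replaced by `i - 1`, the number of distinct values of the word that are smaller. -/
def reduction (u : List ℕ) : List ℕ :=
  u.map fun x => (u.toFinset.filter fun y => y < x).card

/-- `e` contains the pattern `w` if the entries of `e` at some positions `i_1 < ⋯ < i_k` form a
word (a sublist of `e`) whose reduction is `w`. -/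
def Contains (e w : List ℕ) : Prop :=
  ∃ u : List ℕ, u.Sublist e ∧ reduction u = w

def Avoids (e w : List ℕ) : Prop :=
  ¬ Contains e w

/-- The number of distinct elements of `e`. -/
def dist (e : List ℕ) : ℕ :=
  e.toFinset.card

/-- The largest entry of `e` (and `0` for the empty sequence). -/
def maxEntry (e : List ℕ) : ℕ :=
  e.toFinset.sup id

/-- The one-based position `p` of the first descent, `e_1 ≤ e_2 ≤ ⋯ ≤ e_p > e_{p+1}`, where
`e_{n+1} = -1`, so that `p = n` for a weakly increasing sequence. -/
def prmx : List ℕ → ℕ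
  | [] => 0
  | [_] => 1
  | a :: b :: l => if b < a then 1 else prmx (b :: l) + 1

/-- The rank `prmx e - max e - 1` of a nonempty sequence, computed in `ℤ`;
the empty sequence has rank `0`. -/
def rank (e : List ℕ) : ℤ :=
  if e = [] then 0 else (prmx e : ℤ) - (maxEntry e : ℤ) - 1

/-- The inversion sequences, of any length, that avoid both `102` and `000`. -/
def IsAvoiding (e : List ℕ) : Prop :=
  IsInversionSeq e ∧ Avoids e [1, 0, 2] ∧ Avoids e [0, 0, 0]

/-- The `(102,000)`-avoiding inversion sequences of length `n` with `m` distinct elements and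
rank `t`. -/
def avoidingSet (n m t : ℕ) : Set (List ℕ) :=
  {e | e.length = n ∧ IsAvoiding e ∧ dist e = m ∧ rank e = (t : ℤ)}

/-- The `(102,000)`-avoiding inversion sequences of arbitrary length with `m` distinct elements
and rank `t`. -/
def avoidingAll (m t : ℕ) : Set (List ℕ) :=
  {e | IsAvoiding e ∧ dist e = m ∧ rank e = (t : ℤ)}

end InvSeq

/-! Deleting every copy of the largest value `M` from a nonempty avoiding sequence leaves an
avoiding sequence `e` with one distinct value fewer. Conversely, a new largest value can only play
the 2 of a 102. So one or two copies of `M` may be inserted exactly when the entries of `e` before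
the last copy are weakly increasing and at least `M` entries precede the first copy
(`isAvoiding_insert_one`, `isAvoiding_insert_two`). The new rank is read off from the insertion, and
the number of insertions leading to rank `t` depends only on the rank `s` of `e`: it is `kernel s t`
(`card_filter_insertions`).

The counts by rank thus satisfy a linear recurrence in `m`, solved by the coefficient of `z ^ m` in
`z ^ t * B ^ (3 * t + 1)`, where `B = 1 + z * B ^ 4`. Indeed `1 / (1 - z * B ^ 3) = B`, so summing
`z ^ s * B ^ (3 * s + c)` over `s ≥ t` just raises `c` by one. The kernel is a threefold suffix sum,
taking `c = 1` to `c = 4`, and `z * B ^ 4 = B - 1` closes the recurrence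
(`sum_shiftedCoeff_mul_kernel`). -/

namespace InvSeq

/-! ### Fuss–Catalan coefficients and their suffix sums -/

/-- The coefficients of the powers `B ^ r` of the series `B = 1 + z * B ^ 4`. -/
def fussCoeff : ℕ → ℕ → ℕ
  | 0, _ => 1
  | _ + 1, 0 => 0
  | n + 1, r + 1 => fussCoeff (n + 1) r + fussCoeff n (r + 4)

/-- The recursion for `B ^ (r + 1) = B ^ r + z * B ^ (r + 4)` matches Pascal's rule; denominators
are cleared so that each step is a polynomial identity. -/
theorem fussCoeff_closed (n r : ℕ) :
    (fussCoeff n (r + 1) : ℚ) * (3 * n + r + 1) = (r + 1) * (Nat.choose (4 * n + r) n : ℚ) := by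
  induction n generalizing r with
  | zero => simp [fussCoeff]
  | succ n ihn =>
    induction r with
    | zero =>
      -- `B ^ 0` contributes nothing in positive degree, so only the `B ^ 4` term of the recursion
      -- survives.
      have h := ihn 3
      have hc : ((4 * n + 3 + 1 : ℕ) : ℚ) * (Nat.choose (4 * n + 3) n : ℚ) =
          (Nat.choose (4 * n + 3 + 1) (n + 1) : ℚ) * ((n + 1 : ℕ) : ℚ) := by
        exact_mod_cast Nat.add_one_mul_choose_eq (4 * n + 3) n
      have hn : (n : ℚ) + 1 ≠ 0 := by positivity
      have e1 : 4 * (n + 1) + 0 = 4 * n + 3 + 1 := by ring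
      rw [e1]
      simp only [fussCoeff, zero_add]
      push_cast at h hc ⊢
      apply mul_right_cancel₀ hn
      linear_combination (n + 1 : ℚ) * h + hc
    | succ r ihr =>
      have h := ihn (r + 4)
      have hc : (Nat.choose (4 * n + r + 4) (n + 1) : ℚ) * (n + 1) =
          (Nat.choose (4 * n + r + 4) n : ℚ) * (3 * n + r + 4) := by
        have h1 := Nat.choose_succ_right_eq (4 * n + r + 4) n
        rw [show 4 * n + r + 4 - n = 3 * n + r + 4 by omega] at h1
        exact_mod_cast h1
      have hn : (n : ℚ) + 1 ≠ 0 := by positivity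
      have hp : (3 * n + r + 4 : ℚ) ≠ 0 := by positivity
      have e1 : 4 * (n + 1) + (r + 1) = (4 * n + r + 4) + 1 := by ring
      have e2 : 4 * (n + 1) + r = 4 * n + r + 4 := by ring
      have e3 : 4 * n + (r + 4) = 4 * n + r + 4 := by ring
      rw [e1, Nat.choose_succ_succ, fussCoeff]
      rw [e2] at ihr
      rw [e3] at h
      -- Both terms of the recursion are brought to the same binomial coefficient, that of `n` out
      -- of `4 * n + r + 4`.
      have h1 : (fussCoeff (n + 1) (r + 1) : ℚ) * (n + 1) =
          (r + 1) * (Nat.choose (4 * n + r + 4) n : ℚ) := by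
        apply mul_right_cancel₀ hp
        push_cast at ihr
        linear_combination (n + 1 : ℚ) * ihr + (r + 1 : ℚ) * hc
      push_cast at h ⊢
      apply mul_right_cancel₀ hn
      linear_combination (3 * n + r + 5 : ℚ) * h1 + (n + 1 : ℚ) * h - (r + 2 : ℚ) * hc

/-- The coefficient of `z ^ m` in `z ^ t * B ^ (3 * t + c)`, where `B = 1 + z * B ^ 4`. -/
def shiftedCoeff (c m t : ℕ) : ℕ :=
  if t ≤ m then fussCoeff (m - t) (3 * t + c) else 0

theorem shiftedCoeff_succ (c m t : ℕ) :
    shiftedCoeff (c + 1) m t = shiftedCoeff c m t + shiftedCoeff (c + 1) m (t + 1) := by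
  unfold shiftedCoeff
  rcases lt_trichotomy t m with h | rfl | h
  · obtain ⟨k, rfl⟩ := Nat.exists_eq_add_of_lt h
    rw [if_pos (by omega), if_pos (by omega), if_pos (by omega),
      show t + k + 1 - t = k + 1 by omega, show t + k + 1 - (t + 1) = k by omega,
      show 3 * t + (c + 1) = 3 * t + c + 1 by ring,
      show 3 * (t + 1) + (c + 1) = 3 * t + c + 4 by ring, fussCoeff]
  · simp [fussCoeff]
  · rw [if_neg (by omega), if_neg (by omega), if_neg (by omega)]

theorem eq_of_eq_add_succ {f g d : ℕ → ℕ} {m : ℕ} (hf0 : ∀ t, m < t → f t = 0)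
    (hg0 : ∀ t, m < t → g t = 0) (hf : ∀ t, f t = d t + f (t + 1))
    (hg : ∀ t, g t = d t + g (t + 1)) (t : ℕ) : f t = g t := by
  induction h : m + 1 - t generalizing t with
  | zero => rw [hf0 t (by omega), hg0 t (by omega)]
  | succ k ih => rw [hf, hg, ih (t + 1) (by omega)]

/-- The binomial weight is a `(j + 1)`-fold suffix sum, and by `shiftedCoeff_succ` each suffix sum
raises `c` by one. Both sides vanish for `t > m` and have equal differences in `t`. -/
theorem sum_shiftedCoeff_mul_choose (m j t : ℕ) :
    ∑ s ∈ Finset.range (m + 1),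
      shiftedCoeff 1 m s * (if t ≤ s then Nat.choose (s - t + j) j else 0) =
      shiftedCoeff (j + 2) m t := by
  have hzero : ∀ j t, m < t → ∑ s ∈ Finset.range (m + 1),
      shiftedCoeff 1 m s * (if t ≤ s then Nat.choose (s - t + j) j else 0) = 0 := by
    intro j t ht
    refine Finset.sum_eq_zero fun s hs => ?_
    rw [Finset.mem_range] at hs
    rw [if_neg (by omega), mul_zero]
  have hzero' : ∀ c t, m < t → shiftedCoeff c m t = 0 := fun c t ht => by
    rw [shiftedCoeff, if_neg (by omega)]
  induction j generalizing t with
  | zero =>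
    refine eq_of_eq_add_succ (hzero 0) (hzero' _) (fun t => ?_) (shiftedCoeff_succ 1 m) t
    have h1 : shiftedCoeff 1 m t =
        ∑ s ∈ Finset.range (m + 1), shiftedCoeff 1 m s * (if t = s then 1 else 0) := by
      simp only [mul_ite, mul_one, mul_zero, Finset.sum_ite_eq, Finset.mem_range]
      split_ifs with h
      · rfl
      · exact hzero' 1 t (by omega)
    rw [h1, ← Finset.sum_add_distrib]
    refine Finset.sum_congr rfl fun s _ => ?_
    rw [← mul_add]
    congr 1
    simp only [Nat.choose_zero_right]
    split_ifs <;> omega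
  | succ j ihj =>
    refine eq_of_eq_add_succ (hzero _) (hzero' _) (fun t => ?_) (shiftedCoeff_succ _ m) t
    rw [← ihj, ← Finset.sum_add_distrib]
    refine Finset.sum_congr rfl fun s _ => ?_
    rw [← mul_add]
    congr 1
    rcases lt_trichotomy t s with h | rfl | h
    · obtain ⟨k, rfl⟩ := Nat.exists_eq_add_of_lt h
      rw [if_pos (by omega), if_pos (by omega), if_pos (by omega),
        show t + k + 1 - t = k + 1 by omega, show t + k + 1 - (t + 1) = k by omega,
        show k + 1 + (j + 1) = (k + 1 + j) + 1 by ring, Nat.choose_succ_succ,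
        show k + (j + 1) = k + 1 + j by ring]
    · simp
    · rw [if_neg (by omega), if_neg (by omega), if_neg (by omega)]

/-- The number of ways in which a sequence of rank `s` gives rise to one of rank `t` when
copies of a new largest value are inserted. -/
def kernel (s t : ℕ) : ℕ :=
  if t = 0 then Nat.choose (s + 2) 2 else Nat.choose (s + 3 - t) 2

/-- For positive rank the extra factor `z` shifts `t` by one. For rank 0 the identity is `z * B ^ 4
= B - 1`, read in positive degree. -/
theorem sum_shiftedCoeff_mul_kernel (m t : ℕ) :
    ∑ s ∈ Finset.range (m + 1), shiftedCoeff 1 m s * kernel s t = shiftedCoeff 1 (m + 1) t := by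
  rcases t with _ | t
  · have h := sum_shiftedCoeff_mul_choose m 2 0
    simp only [zero_le, if_true, Nat.sub_zero] at h
    simp only [kernel, if_true, h]
    simp [shiftedCoeff, fussCoeff]
  · have h := sum_shiftedCoeff_mul_choose m 2 t
    have h2 : shiftedCoeff 1 (m + 1) (t + 1) = shiftedCoeff 4 m t := by
      simp only [shiftedCoeff, Nat.add_le_add_iff_right, Nat.add_sub_add_right]
      rfl
    rw [h2, ← h]
    refine Finset.sum_congr rfl fun s _ => ?_
    rw [kernel, if_neg (by omega)]
    congr 1
    split_ifs with hs
    · congr 1; omega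
    · exact Nat.choose_eq_zero_of_lt (by omega)

theorem shiftedCoeff_one_closed {m t : ℕ} (h : t ≤ m) :
    (shiftedCoeff 1 m t : ℚ) =
      (3 * (t : ℚ) + 1) / (3 * (m : ℚ) + 1) * (Nat.choose (4 * m - t) (m - t) : ℚ) := by
  obtain ⟨n, rfl⟩ := Nat.exists_eq_add_of_le h
  have h1 := fussCoeff_closed n (3 * t)
  have hp : (3 * ((t + n : ℕ) : ℚ) + 1) ≠ 0 := by positivity
  rw [shiftedCoeff, if_pos h, show t + n - t = n by omega,
    show 4 * (t + n) - t = 4 * n + 3 * t by omega]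
  field_simp
  push_cast at h1 ⊢
  linear_combination h1

/-! ### The patterns 102 and 000 without reductions -/

theorem lt_of_card_filter_lt {S : Finset ℕ} {x y : ℕ}
    (h : (S.filter fun z => z < x).card < (S.filter fun z => z < y).card) : x < y := by
  by_contra! hxy
  refine absurd (Finset.card_le_card ?_) (not_le.mpr h)
  exact Finset.monotone_filter_right S fun z _ hz => lt_of_lt_of_le hz hxy

theorem contains_102_iff {e : List ℕ} :
    Contains e [1, 0, 2] ↔ ∃ x y z, [x, y, z].Sublist e ∧ y < x ∧ x < z := by
  constructor
  · rintro ⟨u, hu, hr⟩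
    obtain ⟨x, y, z, rfl⟩ : ∃ x y z, u = [x, y, z] := by
      apply List.length_eq_three.mp
      simpa [reduction] using congrArg List.length hr
    simp only [reduction, List.map_cons, List.map_nil, List.cons.injEq, and_true] at hr
    exact ⟨x, y, z, hu, lt_of_card_filter_lt (hr.2.1.trans_lt (by omega)),
      lt_of_card_filter_lt (hr.1.trans_lt (by omega))⟩
  · rintro ⟨x, y, z, hu, hyx, hxz⟩
    refine ⟨_, hu, ?_⟩
    have h1 : (({x, y, z} : Finset ℕ).filter fun w => w < x) = {y} := by
      ext w; simp only [Finset.mem_filter, Finset.mem_insert, Finset.mem_singleton]; omega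
    have h2 : (({x, y, z} : Finset ℕ).filter fun w => w < y) = ∅ := by
      rw [Finset.filter_eq_empty_iff]
      intro w
      simp only [Finset.mem_insert, Finset.mem_singleton]
      omega
    have h3 : (({x, y, z} : Finset ℕ).filter fun w => w < z) = {x, y} := by
      ext w; simp only [Finset.mem_filter, Finset.mem_insert, Finset.mem_singleton]; omega
    have h4 : [x, y, z].toFinset = {x, y, z} := by simp
    simp only [reduction, List.map_cons, List.map_nil, h4, h1, h2, h3, Finset.card_singleton,
      Finset.card_empty, Finset.card_pair hyx.ne']

theorem contains_000_iff {e : List ℕ} : Contains e [0, 0, 0] ↔ ∃ x, 3 ≤ e.count x := by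
  constructor
  · rintro ⟨u, hu, hr⟩
    obtain ⟨x, y, z, rfl⟩ : ∃ x y z, u = [x, y, z] := by
      apply List.length_eq_three.mp
      simpa [reduction] using congrArg List.length hr
    simp only [reduction, List.map_cons, List.map_nil, List.cons.injEq, and_true,
      Finset.card_eq_zero, Finset.filter_eq_empty_iff, List.mem_toFinset, List.mem_cons,
      List.not_mem_nil, or_false] at hr
    obtain ⟨h1, h2, h3⟩ := hr
    have hxy : y = x := le_antisymm (not_lt.mp (h2 (by simp))) (not_lt.mp (h1 (by simp)))
    have hxz : z = x := le_antisymm (not_lt.mp (h3 (by simp))) (not_lt.mp (h1 (by simp)))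
    subst hxy hxz
    exact ⟨_, List.replicate_sublist_iff.mp hu⟩
  · rintro ⟨x, hx⟩
    exact ⟨_, List.replicate_sublist_iff.mpr hx, by simp [reduction]⟩

theorem avoids_102_iff {e : List ℕ} :
    Avoids e [1, 0, 2] ↔ ∀ x y z, [x, y, z].Sublist e → y < x → z ≤ x := by
  rw [Avoids, contains_102_iff]
  push Not
  rfl

theorem avoids_000_iff {e : List ℕ} : Avoids e [0, 0, 0] ↔ ∀ x, e.count x ≤ 2 := by
  rw [Avoids, contains_000_iff]
  push Not
  exact forall_congr' fun x => by omega

/-! ### Inserting a largest value -/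

/-- Insertion moves `v` to the right, which relaxes its bounds; removal is harmless because entries
of `v` are at most `M`, hence at most `u.length`. -/
theorem isInversionSeq_insert {u v : List ℕ} {M : ℕ} (hv : ∀ x ∈ v, x ≤ M) :
    IsInversionSeq (u ++ M :: v) ↔ IsInversionSeq (u ++ v) ∧ M ≤ u.length := by
  constructor
  · intro h
    have hM : M ≤ u.length := by simpa using h u.length (by simp)
    refine ⟨fun i hi => ?_, hM⟩
    rw [List.getElem_append]
    split_ifs with hu
    · have := h i (by simp; omega)
      rwa [List.getElem_append_left hu] at this
    · exact (hv _ (List.getElem_mem _)).trans (by omega)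
  · rintro ⟨h, hM⟩ i hi
    rw [List.getElem_append]
    split_ifs with hu
    · have := h i (by simp; omega)
      rwa [List.getElem_append_left hu] at this
    · rw [List.getElem_cons]
      split_ifs with h0
      · omega
      · exact (hv _ (List.getElem_mem _)).trans (by omega)

/-- The bound on `v` is weak so that the lemma still applies when `v` contains a second copy of `M`.
-/
theorem avoids_102_insert {u v : List ℕ} {M : ℕ} (hu : ∀ x ∈ u, x ≤ M) (hv : ∀ x ∈ v, x ≤ M) :
    Avoids (u ++ M :: v) [1, 0, 2] ↔ Avoids (u ++ v) [1, 0, 2] ∧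
      ∀ x y, [x, y].Sublist u → y < x → x = M := by
  simp only [avoids_102_iff]
  constructor
  · intro h
    refine ⟨fun x y z hs => h x y z (hs.trans ?_), fun x y hs hyx => ?_⟩
    · exact (List.sublist_cons_self M v).append_left u
    · refine le_antisymm (hu x (hs.subset (by simp))) (h x y M ?_ hyx)
      exact hs.append (List.singleton_sublist.mpr (by simp) : [M].Sublist (M :: v))
  · rintro ⟨h1, h2⟩ x y z hs hyx
    by_contra! hxz
    obtain ⟨l1, l2, hl, h3, h4⟩ := List.sublist_append_iff.mp hs
    have hle : ∀ w ∈ u ++ M :: v, w ≤ M := by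
      intro w hw
      simp only [List.mem_append, List.mem_cons] at hw
      rcases hw with hw | rfl | hw
      exacts [hu _ hw, le_rfl, hv _ hw]
    have hzM : z ≤ M := hle z (hs.subset (by simp))
    rcases List.sublist_cons_iff.mp h4 with h5 | ⟨l3, rfl, h5⟩
    · exact absurd (h1 x y z (hl ▸ h3.append h5) hyx) (not_le.mpr hxz)
    -- The length of `l1` tells which letter of the pattern the new `M` plays; only the role of 2
    -- survives maximality.
    · rcases l1 with _ | ⟨a, _ | ⟨b, _ | ⟨c, l⟩⟩⟩
      · simp at hl; omega
      · simp at hl; omega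
      · simp only [List.cons_append, List.nil_append, List.cons.injEq] at hl
        obtain ⟨rfl, rfl, rfl, _⟩ := hl
        exact hxz.ne (h2 _ _ h3 hyx)
      · simp at hl

theorem pairwise_iff_sublist_pair {u : List ℕ} :
    u.Pairwise (· ≤ ·) ↔ ∀ x y, [x, y].Sublist u → x ≤ y :=
  List.pairwise_iff_forall_sublist

/-! ### Rank and first descent -/

/-- One more than the largest entry of `e`, and `0` for the empty sequence. -/
def top (e : List ℕ) : ℕ :=
  e.toFinset.sup Nat.succ

theorem top_le_iff {e : List ℕ} {N : ℕ} : top e ≤ N ↔ ∀ x ∈ e, x < N := by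
  simp [top, Finset.sup_le_iff]

theorem top_eq_succ {e : List ℕ} {M : ℕ} (hM : M ∈ e) (h : ∀ x ∈ e, x ≤ M) : top e = M + 1 :=
  le_antisymm (top_le_iff.mpr fun x hx => Nat.lt_succ_of_le (h x hx))
    (Nat.succ_le_of_lt (top_le_iff.mp le_rfl M hM))

/-- Using `top` in place of the maximum absorbs the special case of the empty sequence. -/
theorem rank_eq (e : List ℕ) : rank e = (prmx e : ℤ) - top e := by
  unfold rank
  split_ifs with h
  · subst h; simp [prmx, top]
  · have hne : e.toFinset.Nonempty := by simpa [Finset.nonempty_iff_ne_empty] using h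
    obtain ⟨x, hx, hx'⟩ := Finset.exists_mem_eq_sup e.toFinset hne id
    have : top e = maxEntry e + 1 := by
      refine top_eq_succ ?_ fun y hy => ?_
      · rw [maxEntry, hx']; exact List.mem_toFinset.mp hx
      · exact Finset.le_sup (f := id) (List.mem_toFinset.mpr hy)
    rw [this]; push_cast; ring

/-- Identifies `prmx` as the length of the longest weakly increasing prefix, the form in which it
bounds insertion places. -/
theorem pairwise_take_iff_le_prmx {e : List ℕ} {k : ℕ} :
    (k ≤ e.length ∧ (e.take k).Pairwise (· ≤ ·)) ↔ k ≤ prmx e := by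
  induction e generalizing k with
  | nil => simp [prmx]
  | cons a l ih =>
    rcases k with _ | k
    · simp
    · rcases l with _ | ⟨b, l⟩
      · simp [prmx]
      · simp only [prmx]
        split_ifs with hb
        · rcases k with _ | k
          · simp
          · simp; omega
        · rw [Nat.add_le_add_iff_right, ← ih]
          rcases k with _ | k
          · simp
          · simp only [List.take_succ_cons, List.pairwise_cons, List.mem_cons, List.length_cons,
              Nat.add_le_add_iff_right]
            constructor
            · rintro ⟨h1, _, h3⟩; exact ⟨h1, h3⟩
            · rintro ⟨h1, h2, h3⟩
              refine ⟨h1, ?_, h2, h3⟩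
              rintro x (rfl | hx)
              · omega
              · exact (not_lt.mp hb).trans (h2 x hx)

/-- The first descent of `u ++ v` is at the end of `u` if `u` is weakly increasing and ends in
a strict upper bound of the first entry of `v`. -/
theorem prmx_append {u v : List ℕ} {M : ℕ} (hu : (u ++ [M]).Pairwise (· ≤ ·))
    (hv : ∀ x ∈ v.head?, x < M) : prmx (u ++ M :: v) = u.length + 1 := by
  apply le_antisymm
  · by_contra! h
    obtain ⟨h1, h2⟩ := pairwise_take_iff_le_prmx.mpr (Nat.succ_le_of_lt h)
    rcases v with _ | ⟨b, v⟩
    · simp at h1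
    · have : (u ++ M :: b :: v).take (u.length + 1 + 1) = u ++ [M, b] := by
        rw [add_assoc, List.take_length_add_append]; rfl
      rw [Nat.succ_eq_add_one, this] at h2
      have h3 := (List.pairwise_append.mp h2).2.1
      have h4 : b < M := hv b (by simp)
      simp at h3; omega
  · refine pairwise_take_iff_le_prmx.mp ⟨by simp, ?_⟩
    rwa [List.take_length_add_append]

/-! ### Insertions as a bijection -/

theorem isAvoiding_iff {e : List ℕ} : IsAvoiding e ↔
    IsInversionSeq e ∧ Avoids e [1, 0, 2] ∧ ∀ x, e.count x ≤ 2 := by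
  rw [IsAvoiding, avoids_000_iff]

theorem pairwise_iff_of_lt {u : List ℕ} {M : ℕ} (h : ∀ x ∈ u, x < M) :
    (∀ x y, [x, y].Sublist u → y < x → x = M) ↔ u.Pairwise (· ≤ ·) := by
  rw [pairwise_iff_sublist_pair]
  refine forall_congr' fun x => forall_congr' fun y => forall_congr' fun hs => ?_
  have := h x (hs.subset (by simp))
  omega

theorem isAvoiding_insert_one {a b : List ℕ} {M : ℕ} (h : ∀ x ∈ a ++ b, x < M) :
    IsAvoiding (a ++ M :: b) ↔
      IsAvoiding (a ++ b) ∧ a.Pairwise (· ≤ ·) ∧ M ≤ a.length := by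
  have ha : ∀ x ∈ a, x < M := fun x hx => h x (by simp [hx])
  have hb : ∀ x ∈ b, x ≤ M := fun x hx => (h x (by simp [hx])).le
  have hc : (∀ x, (a ++ M :: b).count x ≤ 2) ↔ ∀ x, (a ++ b).count x ≤ 2 := by
    refine forall_congr' fun x => ?_
    by_cases hx : M = x
    · subst hx
      have : (a ++ b).count M = 0 := List.count_eq_zero.mpr fun hm => lt_irrefl _ (h M hm)
      simp only [List.count_append, List.count_cons_self] at this ⊢
      omega
    · simp [List.count_append, List.count_cons_of_ne hx]
  rw [isAvoiding_iff, isAvoiding_iff, isInversionSeq_insert hb,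
    avoids_102_insert (fun x hx => (ha x hx).le) hb, pairwise_iff_of_lt ha, hc]
  tauto

/-- The copies are removed one at a time, the left one first. The later copy gives the stronger
monotonicity condition, the earlier one the stronger bound on `M`. -/
theorem isAvoiding_insert_two {a b c : List ℕ} {M : ℕ} (h : ∀ x ∈ a ++ (b ++ c), x < M) :
    IsAvoiding (a ++ M :: (b ++ M :: c)) ↔
      IsAvoiding (a ++ (b ++ c)) ∧ (a ++ b).Pairwise (· ≤ ·) ∧ M ≤ a.length := by
  have ha : ∀ x ∈ a, x < M := fun x hx => h x (by simp [hx])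
  have hab : ∀ x ∈ a ++ b, x < M := fun x hx => h x (by
    rw [← List.append_assoc]; exact List.mem_append_left _ hx)
  have hc : ∀ x ∈ c, x ≤ M := fun x hx => (h x (by simp [hx])).le
  have hbc : ∀ x ∈ b ++ M :: c, x ≤ M := by
    intro x hx
    simp only [List.mem_append, List.mem_cons] at hx
    rcases hx with hx | rfl | hx
    exacts [(h x (by simp [hx])).le, le_rfl, hc x hx]
  have hcount : (∀ x, (a ++ M :: (b ++ M :: c)).count x ≤ 2) ↔
      ∀ x, (a ++ (b ++ c)).count x ≤ 2 := by
    refine forall_congr' fun x => ?_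
    by_cases hx : M = x
    · subst hx
      have : (a ++ (b ++ c)).count M = 0 :=
        List.count_eq_zero.mpr fun hm => lt_irrefl _ (h M hm)
      simp only [List.count_append, List.count_cons_self] at this ⊢
      omega
    · simp [List.count_append, List.count_cons_of_ne hx]
  rw [isAvoiding_iff, isAvoiding_iff, isInversionSeq_insert hbc,
    avoids_102_insert (fun x hx => (ha x hx).le) hbc, pairwise_iff_of_lt ha, hcount,
    ← List.append_assoc, isInversionSeq_insert hc,
    avoids_102_insert (fun x hx => (hab x hx).le) hc, pairwise_iff_of_lt hab, List.append_assoc,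
    List.length_append]
  have h1 : (a ++ b).Pairwise (· ≤ ·) → a.Pairwise (· ≤ ·) := fun h =>
    (List.pairwise_append.mp h).1
  have h2 : M ≤ a.length → M ≤ a.length + b.length := fun h => by omega
  tauto

/-- Insert a new largest value `M` into `e`, once after the first `q` entries and, provided
that `r ≤ prmx e`, once more after the first `r` entries of `e`. -/
def insertMax (e : List ℕ) (M q r : ℕ) : List ℕ :=
  if r ≤ prmx e then e.take q ++ M :: ((e.take r).drop q ++ M :: e.drop r)
  else e.take q ++ M :: e.drop q

theorem insertMax_of_le {a b c : List ℕ} {M : ℕ}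
    (h : a.length + b.length ≤ prmx (a ++ (b ++ c))) :
    insertMax (a ++ (b ++ c)) M a.length (a.length + b.length) =
      a ++ M :: (b ++ M :: c) := by
  rw [insertMax, if_pos h]
  simp [List.take_append, List.drop_append]

theorem insertMax_of_lt {a b : List ℕ} {M r : ℕ} (h : prmx (a ++ b) < r) :
    insertMax (a ++ b) M a.length r = a ++ M :: b := by
  rw [insertMax, if_neg (not_le.mpr h)]
  simp

/-- The triples `(M, q, r)` for which `insertMax e M q r` is an avoiding sequence with exactly
one more distinct value than `e`. -/
def insertions (e : List ℕ) : Finset (ℕ × ℕ × ℕ) :=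
  (Finset.range (prmx e + 2) ×ˢ Finset.range (prmx e + 2) ×ˢ Finset.range (prmx e + 2)).filter
    fun x => top e ≤ x.1 ∧ x.1 ≤ x.2.1 ∧ x.2.1 ≤ prmx e ∧ x.2.1 ≤ x.2.2

theorem mem_insertions {e : List ℕ} {M q r : ℕ} : (M, q, r) ∈ insertions e ↔
    top e ≤ M ∧ M ≤ q ∧ q ≤ prmx e ∧ q ≤ r ∧ r ≤ prmx e + 1 := by
  simp only [insertions, Finset.mem_filter, Finset.mem_product, Finset.mem_range]
  omega

/-- An insertion puts in the new value once or twice, at prescribed places. -/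
theorem insertMax_cases {e : List ℕ} {M q r : ℕ} (h : (M, q, r) ∈ insertions e) :
    (∃ a b c, e = a ++ (b ++ c) ∧ q = a.length ∧ r = a.length + b.length ∧
      (a ++ b).Pairwise (· ≤ ·) ∧ insertMax e M q r = a ++ M :: (b ++ M :: c)) ∨
    (∃ a b, e = a ++ b ∧ q = a.length ∧ r = prmx e + 1 ∧
      a.Pairwise (· ≤ ·) ∧ insertMax e M q r = a ++ M :: b) := by
  rw [mem_insertions] at h
  obtain ⟨h1, h2, h3, h4, h5⟩ := h
  rcases h5.lt_or_eq with h6 | h6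
  · left
    obtain ⟨hl, hs⟩ := pairwise_take_iff_le_prmx.mpr (Nat.le_of_lt_succ h6)
    have he : e = e.take q ++ ((e.take r).drop q ++ e.drop r) := by
      rw [← List.append_assoc]
      have : e.take q = (e.take r).take q := by rw [List.take_take, min_eq_left h4]
      rw [this, List.take_append_drop, List.take_append_drop]
    have hab : e.take q ++ (e.take r).drop q = e.take r := by
      have : e.take q = (e.take r).take q := by rw [List.take_take, min_eq_left h4]
      rw [this, List.take_append_drop]
    refine ⟨e.take q, (e.take r).drop q, e.drop r, he, by simp; omega, by simp; omega,
      by rwa [hab], ?_⟩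
    rw [insertMax, if_pos (by omega)]
  · right
    obtain ⟨hl, hs⟩ := pairwise_take_iff_le_prmx.mpr h3
    refine ⟨e.take q, e.drop q, (List.take_append_drop q e).symm, by simp; omega, h6, hs, ?_⟩
    rw [insertMax, if_neg (by omega)]

theorem pairwise_append_singleton_of_lt {a : List ℕ} {M : ℕ} (h : a.Pairwise (· ≤ ·))
    (hM : ∀ x ∈ a, x < M) : (a ++ [M]).Pairwise (· ≤ ·) :=
  List.pairwise_append.mpr ⟨h, by simp, fun x hx y hy => by
    rw [List.mem_singleton] at hy; exact hy ▸ (hM x hx).le⟩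

theorem filter_ne_of_lt {a : List ℕ} {M : ℕ} (h : ∀ x ∈ a, x < M) :
    a.filter (fun x => x ≠ M) = a :=
  List.filter_eq_self.mpr fun x hx => by simpa using (h x hx).ne

section

variable {e : List ℕ} {M q r : ℕ}

theorem lt_of_mem_insertions (h : (M, q, r) ∈ insertions e) : ∀ x ∈ e, x < M :=
  top_le_iff.mp (mem_insertions.mp h).1

theorem filter_ne_insertMax (h : (M, q, r) ∈ insertions e) :
    (insertMax e M q r).filter (fun x => x ≠ M) = e := by
  have hlt := filter_ne_of_lt (lt_of_mem_insertions h)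
  rcases insertMax_cases h with ⟨a, b, c, rfl, -, -, -, h1⟩ | ⟨a, b, rfl, -, -, -, h1⟩ <;>
  · rw [h1]
    simpa [List.filter_append] using hlt

theorem toFinset_insertMax (h : (M, q, r) ∈ insertions e) :
    (insertMax e M q r).toFinset = insert M e.toFinset := by
  rcases insertMax_cases h with ⟨a, b, c, rfl, -, -, -, h1⟩ | ⟨a, b, rfl, -, -, -, h1⟩ <;>
  · rw [h1]
    ext x
    simp only [List.mem_toFinset, List.mem_append, List.mem_cons, Finset.mem_insert]
    tauto

theorem dist_insertMax (h : (M, q, r) ∈ insertions e) :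
    dist (insertMax e M q r) = dist e + 1 := by
  rw [dist, toFinset_insertMax h, Finset.card_insert_of_notMem, dist]
  exact fun hM => lt_irrefl _ (lt_of_mem_insertions h M (List.mem_toFinset.mp hM))

theorem top_insertMax (h : (M, q, r) ∈ insertions e) : top (insertMax e M q r) = M + 1 := by
  rw [top, toFinset_insertMax h, Finset.sup_insert]
  exact max_eq_left ((mem_insertions.mp h).1.trans (Nat.le_succ M))

theorem isAvoiding_insertMax (he : IsAvoiding e) (h : (M, q, r) ∈ insertions e) :
    IsAvoiding (insertMax e M q r) := by
  have hlt := lt_of_mem_insertions h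
  have hM := (mem_insertions.mp h).2.1
  rcases insertMax_cases h with ⟨a, b, c, rfl, rfl, -, hs, h1⟩ | ⟨a, b, rfl, rfl, -, hs, h1⟩
  · rw [h1, isAvoiding_insert_two hlt]
    exact ⟨he, hs, hM⟩
  · rw [h1, isAvoiding_insert_one hlt]
    exact ⟨he, hs, hM⟩

theorem prmx_insertMax (h : (M, q, r) ∈ insertions e) :
    prmx (insertMax e M q r) = if q = r then q + 2 else q + 1 := by
  have hlt := lt_of_mem_insertions h
  have hq := (mem_insertions.mp h).2.2.1
  rcases insertMax_cases h with ⟨a, b, c, rfl, rfl, rfl, hs, h1⟩ | ⟨a, b, rfl, rfl, rfl, hs, h1⟩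
  · have ha := pairwise_append_singleton_of_lt (List.pairwise_append.mp hs).1
      (fun x hx => hlt x (by simp [hx]))
    rw [h1]
    -- Adjacent copies both belong to the increasing prefix; otherwise the descent comes right after
    -- the first copy.
    rcases b with _ | ⟨x, b⟩
    · have h2 : (a ++ [M] ++ [M]).Pairwise (· ≤ ·) := by
        refine List.pairwise_append.mpr ⟨ha, by simp, fun x hx y hy => ?_⟩
        rw [List.mem_singleton] at hy
        rw [List.mem_append, List.mem_singleton] at hx
        rcases hx with hx | rfl
        · exact hy ▸ (hlt x (by simp [hx])).le
        · exact hy.ge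
      have h3 := prmx_append (v := c) h2 fun x hx => hlt x (by
        simp [List.mem_of_mem_head? hx])
      simpa using h3
    · rw [prmx_append ha (fun y hy => hlt y (by simp at hy; simp [hy])), if_neg (by simp)]
  · have ha := pairwise_append_singleton_of_lt hs (fun x hx => hlt x (by simp [hx]))
    rw [h1, prmx_append ha (fun y hy => hlt y (by simp [List.mem_of_mem_head? hy])),
      if_neg (by omega)]

end

theorem append_cons_inj {a b a' b' : List ℕ} {M : ℕ} (ha : M ∉ a) (ha' : M ∉ a')
    (h : a ++ M :: b = a' ++ M :: b') : a = a' ∧ b = b' := by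
  induction a generalizing a' with
  | nil =>
    rcases a' with _ | ⟨x, a'⟩
    · simpa using h
    · simp only [List.nil_append, List.cons_append, List.cons.injEq] at h
      simp [h.1] at ha'
  | cons y a ih =>
    rcases a' with _ | ⟨x, a'⟩
    · simp only [List.nil_append, List.cons_append, List.cons.injEq] at h
      simp [h.1] at ha
    · simp only [List.cons_append, List.cons.injEq, List.mem_cons, not_or] at h ha ha'
      obtain ⟨h1, h2⟩ := ih ha.2 ha'.2 h.2
      exact ⟨by rw [h.1, h1], h2⟩

/-- `M` is recovered from `top`, and the places from splitting at successive occurrences of `M`. -/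
theorem insertMax_inj {e : List ℕ} {M q r M' q' r' : ℕ} (h : (M, q, r) ∈ insertions e)
    (h' : (M', q', r') ∈ insertions e) (heq : insertMax e M q r = insertMax e M' q' r') :
    (M, q, r) = (M', q', r') := by
  have hM : M = M' := by
    have := top_insertMax h
    rw [heq, top_insertMax h'] at this
    omega
  subst hM
  have hlt : M ∉ e := fun hm => lt_irrefl _ (lt_of_mem_insertions h M hm)
  rcases insertMax_cases h with ⟨a, b, c, h1, h2, h3, -, h4⟩ | ⟨a, b, h1, h2, h3, -, h4⟩ <;>
  rcases insertMax_cases h' with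
    ⟨a', b', c', h1', h2', h3', -, h4'⟩ | ⟨a', b', h1', h2', h3', -, h4'⟩ <;>
  · rw [h4, h4'] at heq
    have m1 := hlt
    have m2 := hlt
    rw [h1] at m1
    rw [h1'] at m2
    simp only [List.mem_append, not_or] at m1 m2
    obtain ⟨r1, r2⟩ := append_cons_inj m1.1 m2.1 heq
    subst r1
    -- The two contradictory alternatives are the mixed cases, one copy against two.
    first
    | (obtain ⟨r3, -⟩ := append_cons_inj m1.2.1 m2.2.1 r2; rw [h2, h2', h3, h3', r3])
    | (exfalso; simp [← r2] at m2; done)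
    | (exfalso; simp [r2] at m1; done)
    | (rw [h2, h2', h3, h3'])

theorem exists_insertMax_eq {l : List ℕ} (hl : IsAvoiding l) (hne : l ≠ []) :
    ∃ e M q r, IsAvoiding e ∧ (M, q, r) ∈ insertions e ∧ insertMax e M q r = l := by
  obtain ⟨M, hM, hle⟩ : ∃ M ∈ l, ∀ x ∈ l, x ≤ M := by
    obtain ⟨M, hM, h⟩ := Finset.exists_max_image l.toFinset id (by
      simpa [Finset.nonempty_iff_ne_empty] using hne)
    exact ⟨M, List.mem_toFinset.mp hM, fun x hx => h x (List.mem_toFinset.mpr hx)⟩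
  obtain ⟨a, b, rfl, ha⟩ := List.eq_append_cons_of_mem hM
  have halt : ∀ x ∈ a, x < M := fun x hx =>
    lt_of_le_of_ne (hle x (by simp [hx])) fun h => ha (h ▸ hx)
  by_cases hb : M ∈ b
  · obtain ⟨b, c, rfl, hb⟩ := List.eq_append_cons_of_mem hb
    have hc : M ∉ c := by
      intro hc
      have h1 := (isAvoiding_iff.mp hl).2.2 M
      have h2 := List.count_pos_iff.mpr hc
      simp only [List.count_append, List.count_cons_self] at h1
      omega
    have hlt : ∀ x ∈ a ++ (b ++ c), x < M := by
      intro x hx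
      refine lt_of_le_of_ne (hle x ?_) fun h => ?_ <;> simp only [List.mem_append] at hx
      · simp only [List.mem_append, List.mem_cons]; tauto
      · subst h; tauto
    obtain ⟨h1, h2, h3⟩ := (isAvoiding_insert_two hlt).mp hl
    have hp : a.length + b.length ≤ prmx (a ++ (b ++ c)) := by
      refine pairwise_take_iff_le_prmx.mp ⟨by simp, ?_⟩
      rwa [← List.append_assoc, ← List.length_append, List.take_left]
    refine ⟨a ++ (b ++ c), M, a.length, a.length + b.length, h1, ?_, insertMax_of_le hp⟩
    exact mem_insertions.mpr ⟨top_le_iff.mpr hlt, h3, by omega, by omega, by omega⟩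
  · have hlt : ∀ x ∈ a ++ b, x < M := by
      intro x hx
      refine lt_of_le_of_ne (hle x ?_) fun h => ?_ <;> simp only [List.mem_append] at hx
      · simp only [List.mem_append, List.mem_cons]; tauto
      · subst h; tauto
    obtain ⟨h1, h2, h3⟩ := (isAvoiding_insert_one hlt).mp hl
    have hp : a.length ≤ prmx (a ++ b) := by
      refine pairwise_take_iff_le_prmx.mp ⟨by simp, ?_⟩
      rwa [List.take_left]
    refine ⟨a ++ b, M, a.length, prmx (a ++ b) + 1, h1, ?_, insertMax_of_lt (by omega)⟩
    exact mem_insertions.mpr ⟨top_le_iff.mpr hlt, h3, hp, by omega, by omega⟩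

theorem isAvoiding_nil : IsAvoiding [] := by
  rw [isAvoiding_iff, avoids_102_iff]
  exact ⟨fun i hi => by simp at hi, fun x y z h => by simp at h, by simp⟩

/-- Ranks are nonnegative, so the truncated difference `prmx e - top e` is the true rank. -/
theorem top_le_prmx {e : List ℕ} (he : IsAvoiding e) : top e ≤ prmx e := by
  by_cases hne : e = []
  · subst hne; simp [top]
  · obtain ⟨e, M, q, r, -, h, rfl⟩ := exists_insertMax_eq he hne
    rw [top_insertMax h, prmx_insertMax h]
    have := mem_insertions.mp h
    split_ifs <;> omega

/-! ### Counting by rank -/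

/-- The avoiding sequences with `m` distinct values. -/
def avoidingFinset : ℕ → Finset (List ℕ)
  | 0 => {[]}
  | m + 1 => (avoidingFinset m).biUnion fun e =>
      (insertions e).image fun x => insertMax e x.1 x.2.1 x.2.2

theorem mem_avoidingFinset {m : ℕ} {l : List ℕ} :
    l ∈ avoidingFinset m ↔ IsAvoiding l ∧ dist l = m := by
  induction m generalizing l with
  | zero =>
    simp only [avoidingFinset, Finset.mem_singleton, dist, Finset.card_eq_zero,
      List.toFinset_eq_empty_iff]
    exact ⟨fun h => ⟨h ▸ isAvoiding_nil, h⟩, And.right⟩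
  | succ m ih =>
    simp only [avoidingFinset, Finset.mem_biUnion, Finset.mem_image, Prod.exists, ih]
    constructor
    · rintro ⟨e, ⟨he, hd⟩, M, q, r, h, rfl⟩
      exact ⟨isAvoiding_insertMax he h, by rw [dist_insertMax h, hd]⟩
    · rintro ⟨hl, hd⟩
      obtain ⟨e, M, q, r, he, h, rfl⟩ := exists_insertMax_eq hl (by
        rintro rfl; simp [dist] at hd)
      rw [dist_insertMax h] at hd
      exact ⟨e, ⟨he, by omega⟩, M, q, r, h, rfl⟩

theorem card_filter_insertions {e : List ℕ} (he : top e ≤ prmx e) (t : ℕ) :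
    ((insertions e).filter fun x =>
      (if x.2.1 = x.2.2 then x.2.1 + 2 else x.2.1 + 1) - (x.1 + 1) = t).card =
      kernel (prmx e - top e) t := by
  have hD : ∀ n, ((Finset.range n).sigma fun v => Finset.range v).card = n.choose 2 := by
    intro n
    simp only [Finset.card_sigma, Finset.card_range]
    rw [Finset.sum_range_id, Nat.choose_two_right]
  generalize hN : top e = N at *
  generalize hp : prmx e = p at *
  unfold kernel
  split_ifs with ht
  -- Rank 0 forces `M = q < r`, so only the pair `q < r` between `N` and `p + 1` is free.
  · rw [← hD]
    refine Finset.card_nbij' (fun x => ⟨x.2.2 - N, x.2.1 - N⟩)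
      (fun y => (y.2 + N, y.2 + N, y.1 + N)) ?_ ?_ ?_ ?_
    · rintro ⟨M, q, r⟩ h
      simp only [Finset.coe_filter, Set.mem_ofPred_eq, mem_insertions, hN, hp] at h
      simp only [Finset.coe_sigma, Set.mem_sigma_iff, Finset.coe_range, Set.mem_Iio]
      split_ifs at h <;> omega
    · rintro ⟨v, u⟩ h
      simp only [Finset.coe_sigma, Set.mem_sigma_iff, Finset.coe_range, Set.mem_Iio] at h
      simp only [Finset.coe_filter, Set.mem_ofPred_eq, mem_insertions, hN, hp]
      split_ifs <;> omega
    · rintro ⟨M, q, r⟩ h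
      simp only [Finset.coe_filter, Set.mem_ofPred_eq, mem_insertions, hN, hp] at h
      simp only [Prod.mk.injEq]
      split_ifs at h <;> omega
    · rintro ⟨v, u⟩ h
      simp
  -- Either `q < r` and `M = q - t`, or `q = r` and `M = q + 1 - t`. The second family is encoded by
  -- `u = 0`, the first by `u > 0`.
  · rw [← hD]
    refine Finset.card_nbij'
      (fun x => if x.2.1 = x.2.2 then ⟨x.2.1 + 2 - (N + t), 0⟩
        else ⟨x.2.2 + 1 - (N + t), x.2.1 + 1 - (N + t)⟩)
      (fun y => if y.2 = 0 then (y.1 + N - 1, y.1 + N + t - 2, y.1 + N + t - 2)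
        else (y.2 + N - 1, y.2 + N + t - 1, y.1 + N + t - 1)) ?_ ?_ ?_ ?_
    · rintro ⟨M, q, r⟩ h
      simp only [Finset.coe_filter, Set.mem_ofPred_eq, mem_insertions, hN, hp] at h
      simp only [Finset.coe_sigma, Set.mem_sigma_iff, Finset.coe_range, Set.mem_Iio]
      split_ifs at h ⊢ <;> simp only <;> omega
    · rintro ⟨v, u⟩ h
      simp only [Finset.coe_sigma, Set.mem_sigma_iff, Finset.coe_range, Set.mem_Iio] at h
      simp only [Finset.coe_filter, Set.mem_ofPred_eq]
      by_cases hu : u = 0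
      · simp only [hu, if_true, mem_insertions, hN, hp]
        omega
      · simp only [hu, if_false, mem_insertions, hN, hp]
        split_ifs <;> omega
    · rintro ⟨M, q, r⟩ h
      simp only [Finset.coe_filter, Set.mem_ofPred_eq, mem_insertions, hN, hp] at h
      simp only
      by_cases hqr : q = r
      · simp only [hqr, if_true, Prod.mk.injEq] at h ⊢
        omega
      · simp only [hqr, if_false] at h ⊢
        rw [if_neg (by omega)]
        simp only [Prod.mk.injEq]
        omega
    · rintro ⟨v, u⟩ h
      simp only [Finset.coe_sigma, Set.mem_sigma_iff, Finset.coe_range, Set.mem_Iio] at h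
      by_cases hu : u = 0
      · simp only [hu, if_true, Sigma.mk.injEq, heq_eq_eq, and_true]
        omega
      · simp only [hu, if_false]
        rw [if_neg (by omega)]
        simp only [Sigma.mk.injEq, heq_eq_eq]
        omega

theorem card_rank_succ (m t : ℕ) :
    ((avoidingFinset (m + 1)).filter fun l => prmx l - top l = t).card =
      ∑ e ∈ avoidingFinset m, kernel (prmx e - top e) t := by
  rw [avoidingFinset, Finset.filter_biUnion, Finset.card_biUnion]
  · refine Finset.sum_congr rfl fun e he => ?_
    rw [Finset.filter_image, Finset.card_image_of_injOn,
      ← card_filter_insertions (top_le_prmx (mem_avoidingFinset.mp he).1)]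
    · congr 1
      refine Finset.filter_congr ?_
      rintro ⟨M, q, r⟩ h
      rw [prmx_insertMax h, top_insertMax h]
    · rintro ⟨M, q, r⟩ h ⟨M', q', r'⟩ h' heq
      exact insertMax_inj (Finset.mem_filter.mp h).1 (Finset.mem_filter.mp h').1 heq
  · intro e _ e' _ hne
    -- The parent is determined by its child: `top` gives `M`, and deleting `M` gives the parent.
    refine Finset.disjoint_left.mpr fun l hl hl' => hne ?_
    simp only [Finset.mem_filter, Finset.mem_image, Prod.exists] at hl hl'
    obtain ⟨⟨M, q, r, h, rfl⟩, -⟩ := hl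
    obtain ⟨⟨M', q', r', h', heq⟩, -⟩ := hl'
    have hM : M' = M := by
      have := top_insertMax h'
      rw [heq, top_insertMax h] at this
      omega
    subst hM
    rw [← filter_ne_insertMax h, ← heq, filter_ne_insertMax h']

theorem card_rank (m t : ℕ) :
    ((avoidingFinset m).filter fun l => prmx l - top l = t).card = shiftedCoeff 1 m t := by
  induction m generalizing t with
  | zero =>
    rw [avoidingFinset, Finset.filter_singleton]
    rcases t with _ | t
    · simp [prmx, shiftedCoeff, fussCoeff]
    · simp [prmx, shiftedCoeff]
  | succ m ih =>
    -- The induction hypothesis itself bounds the rank by `m`: the count for any larger rank is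
    -- zero.
    have hmaps : ∀ e ∈ avoidingFinset m, prmx e - top e ∈ Finset.range (m + 1) := by
      intro e he
      by_contra hr
      rw [Finset.mem_range] at hr
      have h1 := ih (prmx e - top e)
      rw [shiftedCoeff, if_neg (by omega), Finset.card_eq_zero] at h1
      exact Finset.notMem_empty e (h1 ▸ Finset.mem_filter.mpr ⟨he, rfl⟩)
    rw [card_rank_succ, ← sum_shiftedCoeff_mul_kernel, ← Finset.sum_fiberwise_of_maps_to hmaps]
    refine Finset.sum_congr rfl fun s _ => ?_
    rw [← ih, Finset.card_eq_sum_ones, Finset.sum_mul]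
    refine Finset.sum_congr rfl fun e he => ?_
    rw [(Finset.mem_filter.mp he).2, one_mul]

/-! ### Length bounds and the final count -/

theorem avoidingAll_eq (m t : ℕ) : avoidingAll m t =
    ((avoidingFinset m).filter fun l => prmx l - top l = t : Finset (List ℕ)) := by
  ext l
  simp only [avoidingAll, Set.mem_ofPred_eq, Finset.coe_filter, mem_avoidingFinset, rank_eq,
    and_assoc]
  refine and_congr_right fun hl => and_congr_right fun _ => ?_
  have := top_le_prmx hl
  omega

theorem dist_le_length (l : List ℕ) : dist l ≤ l.length :=
  List.toFinset_card_le l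

theorem length_le_two_mul_dist {l : List ℕ} (hl : IsAvoiding l) : l.length ≤ 2 * dist l := by
  rw [← List.sum_toFinset_count_eq_length, dist, mul_comm]
  exact Finset.sum_le_card_nsmul _ _ _ fun x _ => (isAvoiding_iff.mp hl).2.2 x

theorem avoidingAll_eq_iUnion (m t : ℕ) :
    avoidingAll m t = ⋃ n ∈ Set.Icc m (2 * m), avoidingSet n m t := by
  ext l
  simp only [avoidingAll, avoidingSet, Set.mem_iUnion, Set.mem_ofPred_eq, Set.mem_Icc,
    exists_prop]
  constructor
  · rintro ⟨h1, rfl, h3⟩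
    exact ⟨l.length, ⟨dist_le_length l, length_le_two_mul_dist h1⟩, rfl, h1, rfl, h3⟩
  · rintro ⟨n, -, -, h⟩
    exact h

theorem ncard_avoidingAll {m t : ℕ} (h : t ≤ m) : ((avoidingAll m t).ncard : ℚ) =
    (3 * (t : ℚ) + 1) / (3 * (m : ℚ) + 1) * (Nat.choose (4 * m - t) (m - t) : ℚ) := by
  rw [avoidingAll_eq, Set.ncard_coe_finset, card_rank, shiftedCoeff_one_closed h]

end InvSeq

theorem mainTheorem3 :
    (∀ m t : ℕ, t ≤ m →
      (InvSeq.avoidingAll m t = ⋃ n ∈ Set.Icc m (2 * m), InvSeq.avoidingSet n m t) ∧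
      (InvSeq.avoidingAll m t).Finite ∧
      ((InvSeq.avoidingAll m t).ncard : ℚ) =
        (3 * (t : ℚ) + 1) / (3 * (m : ℚ) + 1) * (Nat.choose (4 * m - t) (m - t) : ℚ)) ∧
    (∀ m : ℕ,
      ((InvSeq.avoidingAll m 0).ncard : ℚ) =
        1 / (3 * (m : ℚ) + 1) * (Nat.choose (4 * m) m : ℚ)) := by
  refine ⟨fun m t h => ⟨InvSeq.avoidingAll_eq_iUnion m t, ?_, InvSeq.ncard_avoidingAll h⟩,
    fun m => ?_⟩
  · rw [InvSeq.avoidingAll_eq]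
    exact Finset.finite_toSet _
  · simpa using InvSeq.ncard_avoidingAll (Nat.zero_le m)
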